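/- Let $H$ be a complex Hilbert space and, for $t\ge 0$, let $L(t):\mathcal B(H)\to\mathcal B(H)$ be a bounded linear map. Call such a time-dependent generator non-singular if $t\mapsto L(t)$ is locally (Bochner) integrable on $[0,\infty)$ in the operator norm. The dynamical map of the master equation $\frac{d\varrho}{dt}=L(t)[\varrho]$ is the continuous family $\Phi(t)$, $t\ge0$, of bounded linear maps on $\mathcal B(H)$ with $\Phi(t)=\mathrm{Id}+\int_0^t L(s)\,\Phi(s)\,ds$ for all $t\ge 0$ (that is, $\Phi(t)=T_{\leftarrow}\exp\int_0^tL(s)\,ds$). A family $\Phi$ is called CP divisible if for all $t_2>t_1\ge 0$ there is a completely positive map $V(t_2,t_1)$ on $\mathcal B(H)$ with $\Phi(t_2)=V(t_2,t_1)\Phi(t_1)$. Suppose that $L$ is non-singular. Then the master equation $\frac{d\varrho}{dt}=L(t)[\varrho]$ has a CP divisible dynamical map if and only if, for every locally integrable time-stretching function $\alpha:[0,\infty)\to[0,\infty)$ for which $\alpha L$ is again non-singular (this is automatic if $L$ is locally bounded), the deformed master equation $\frac{d\varrho}{dt}=\alpha(t)L(t)[\varrho]$ has a dynamical map $\widetilde\Phi(t)$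 that is completely positive for every $t\ge 0$. -/

import Mathlib

open Set MeasureTheory
open scoped CStarAlgebra ComplexOrder

/-- Superoperators: bounded linear maps `A → A` on a complex Banach algebra of operators, here
`A = B(H)`. They carry the operator norm, and their product is composition. (For finite-dimensional
`H` these are all the linear maps on operators.) -/
abbrev SuperOp (A : Type*) [NormedAddCommGroup A] [NormedSpace ℂ A] : Type _ := A →L[ℂ] A

/-- Complete positivity: for every `k`, the map `Ψ ⊗ Id_k`, i.e. the entrywise application of `Ψ`
to `k × k` matrices over `A`, sends positive elements to positive elements. -/
def IsCP {A : Type*} [CStarAlgebra A] [PartialOrder A] [StarOrderedRing A]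
    (Ψ : SuperOp A) : Prop :=
  ∃ F : A →CP A, ∀ X : A, F X = Ψ X

/-- A time-local generator is non-singular if it is locally (Bochner) integrable on `[0, ∞)` in
the norm of superoperators, so that the time-ordered exponential of `∫ L` is defined. -/
def NonSingular {A : Type*} [NormedAddCommGroup A] [NormedSpace ℂ A]
    (L : ℝ → SuperOp A) : Prop :=
  LocallyIntegrableOn L (Ici (0 : ℝ))

/-- `Φ` is the dynamical map of the master equation `dρ/dt = L(t)[ρ]`, i.e. the continuous
solution on `[0, ∞)` of `dΦ/dt = L(t) ∘ Φ(t)`, `Φ(0) = Id`, in the integrated (Carathéodory) form;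
the generator need not be continuous in time. -/
def IsDynamicalMap {A : Type*} [NormedAddCommGroup A] [NormedSpace ℂ A]
    (L Φ : ℝ → SuperOp A) : Prop :=
  ContinuousOn Φ (Ici (0 : ℝ)) ∧
    ∀ t : ℝ, 0 ≤ t → Φ t = 1 + ∫ s in (0 : ℝ)..t, L s * Φ s

/-- `Φ` is CP divisible: `Φ(t₂) = V ∘ Φ(t₁)` with a CP intermediate map `V = V(t₂, t₁)`, for all
`t₂ > t₁ ≥ 0`. -/
def CPDivisible {A : Type*} [CStarAlgebra A] [PartialOrder A] [StarOrderedRing A]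
    (Φ : ℝ → SuperOp A) : Prop :=
  ∀ t₁ t₂ : ℝ, 0 ≤ t₁ → t₁ < t₂ → ∃ V : SuperOp A, IsCP V ∧ Φ t₂ = V * Φ t₁

/-- A time-stretching function: real, non-negative on `[0, ∞)` and locally integrable there, so
that the deformed time `τ(t) = ∫₀ᵗ α` is defined. -/
def IsTimeStretching (α : ℝ → ℝ) : Prop :=
  (∀ t : ℝ, 0 ≤ t → 0 ≤ α t) ∧ LocallyIntegrableOn α (Ici (0 : ℝ))

/-! The completely positive maps form a closed convex cone `C`, stable under composition and
containing the identity; this is all that the proof uses about them (`IsClosedMulCone`).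

If every deformation is CP, take `α` to be the indicator of `(a, ∞)`. The deformed evolution rests
until time `a` and then follows `L`, so its value at `t` is the propagator from `a` to `t`
(`linear_solution_eq_mul`), which is therefore CP.

Conversely, let `Φ` be CP divisible. Each `Φ x` is invertible (`isUnit_linear_solution`), so for
almost every `x` the quotients `(V(x + r, x) - 1) / r` converge to `L x`. Hence `L x` lies in the
closure of `shiftedCone C`, the maps that enter `C` after a multiple of the identity is added
(`ae_mem_closure_shiftedCone`). That closure is stable under multiplication by `α x ≥ 0`. Finally, a
generator with values there almost everywhere has its solution in `C`
(`linear_solution_mem_of_ae_mem_closure`): approximate it in `L¹` by simple functions with values in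
`shiftedCone C`, undo the shift by an exponential factor, and pass to the limit by Gronwall. -/

open Filter Topology

/-! ### Fundamental theorem of calculus for absolutely continuous vector-valued functions. -/

section AbsolutelyContinuous

variable {X Y : Type*} [PseudoMetricSpace X] [PseudoMetricSpace Y]
variable {E : Type*} [NormedAddCommGroup E] [NormedSpace ℝ E]

theorem AbsolutelyContinuousOnInterval.of_dist_le {f : ℝ → X} {g : ℝ → Y} {a b C : ℝ}
    (hg : AbsolutelyContinuousOnInterval g a b)
    (h : ∀ x ∈ uIcc a b, ∀ y ∈ uIcc a b, dist (f x) (f y) ≤ C * dist (g x) (g y)) :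
    AbsolutelyContinuousOnInterval f a b := by
  rw [absolutelyContinuousOnInterval_iff] at hg ⊢
  intro ε hε
  obtain ⟨δ, hδ, H⟩ := hg (ε / (|C| + 1)) (by positivity)
  refine ⟨δ, hδ, fun E hE hlt => ?_⟩
  have h1 := H E hE hlt
  have hmem : ∀ i ∈ Finset.range E.1, (E.2 i).1 ∈ uIcc a b ∧ (E.2 i).2 ∈ uIcc a b := by
    simpa using hE.1
  calc ∑ i ∈ Finset.range E.1, dist (f (E.2 i).1) (f (E.2 i).2)
      ≤ ∑ i ∈ Finset.range E.1, (|C| + 1) * dist (g (E.2 i).1) (g (E.2 i).2) := by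
        refine Finset.sum_le_sum fun i hi => ?_
        refine (h _ (hmem i hi).1 _ (hmem i hi).2).trans ?_
        gcongr
        linarith [le_abs_self C]
    _ = (|C| + 1) * ∑ i ∈ Finset.range E.1, dist (g (E.2 i).1) (g (E.2 i).2) := by
        rw [Finset.mul_sum]
    _ < (|C| + 1) * (ε / (|C| + 1)) := by gcongr
    _ = ε := by field_simp

theorem IntervalIntegrable.absolutelyContinuousOnInterval_integral {f : ℝ → E} {a b : ℝ}
    (h : IntervalIntegrable f volume a b) :
    AbsolutelyContinuousOnInterval (fun x => ∫ s in a..x, f s) a b := by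
  refine (h.norm.absolutelyContinuousOnInterval_intervalIntegral (c := a) left_mem_uIcc).of_dist_le
    (C := 1) fun x hx y hy => ?_
  have hi : ∀ z ∈ uIcc a b, IntervalIntegrable f volume a z := fun z hz =>
    h.mono_set (uIcc_subset_uIcc left_mem_uIcc hz)
  rw [dist_eq_norm, dist_eq_norm, one_mul,
    intervalIntegral.integral_interval_sub_left (hi x hx) (hi y hy),
    intervalIntegral.integral_interval_sub_left (hi x hx).norm (hi y hy).norm]
  exact intervalIntegral.norm_integral_le_abs_integral_norm

variable [CompleteSpace E]

/-- `f` minus the primitive of `f'` is absolutely continuous with derivative zero almost everywhere,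
hence constant. -/
theorem AbsolutelyContinuousOnInterval.integral_eq_sub_of_ae_hasDerivAt {f f' : ℝ → E} {a b : ℝ}
    (hf : AbsolutelyContinuousOnInterval f a b) (hf' : IntervalIntegrable f' volume a b)
    (hd : ∀ᵐ x, x ∈ uIcc a b → HasDerivAt f (f' x) x) :
    ∫ x in a..b, f' x = f b - f a := by
  have h0 : ∀ᵐ x, x ∈ uIcc a b → HasDerivAt (fun x => f x - ∫ s in a..x, f' s) 0 x := by
    filter_upwards [hd, hf'.ae_hasDerivAt_integral] with x h1 h2 hx
    simpa using (h1 hx).fun_sub (h2 hx a left_mem_uIcc)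
  obtain ⟨C, hC⟩ :=
    (hf.fun_sub hf'.absolutelyContinuousOnInterval_integral).const_of_ae_hasDerivAt_zero h0
  have ha := hC a left_mem_uIcc
  have hb := hC b right_mem_uIcc
  simp only [intervalIntegral.integral_same, sub_zero] at ha
  rw [ha, ← hb]
  abel

end AbsolutelyContinuous

/-! ### Gronwall's inequality. -/

section Gronwall

theorem MeasureTheory.LocallyIntegrableOn.intervalIntegrable_of_nonneg {E : Type*}
    [NormedAddCommGroup E] {K : ℝ → E} (hK : LocallyIntegrableOn K (Ici (0 : ℝ))) {a b : ℝ}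
    (ha : 0 ≤ a) (hb : 0 ≤ b) : IntervalIntegrable K volume a b := by
  refine IntegrableOn.intervalIntegrable
    (hK.integrableOn_compact_subset (fun x hx => ?_) isCompact_uIcc)
  exact (le_min ha hb).trans hx.1

/-- With `m` the primitive of `k`, the integrand is almost everywhere the derivative of `exp (2 * m)
/ 2`. The 2 in the exponent yields the factor 1/2 that serves below for absorption and contraction.
-/
theorem integral_mul_exp_integral {k : ℝ → ℝ} {T : ℝ} (hk : IntervalIntegrable k volume 0 T) :
    ∫ s in (0 : ℝ)..T, k s * Real.exp (2 * ∫ r in (0 : ℝ)..s, k r)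
      = (Real.exp (2 * ∫ r in (0 : ℝ)..T, k r) - 1) / 2 := by
  set m : ℝ → ℝ := fun s => ∫ r in (0 : ℝ)..s, k r with hm
  have hac : AbsolutelyContinuousOnInterval m 0 T := hk.absolutelyContinuousOnInterval_integral
  obtain ⟨C, hC⟩ := hac.exists_bound
  have hexp : ContDiffOn ℝ 1 (fun x : ℝ => Real.exp (2 * x) / 2) (Icc (-C) C) := by fun_prop
  obtain ⟨M, hM⟩ := hexp.exists_lipschitzOnWith (by decide) (convex_Icc _ _) isCompact_Icc
  have hmem : ∀ x ∈ uIcc 0 T, m x ∈ Icc (-C) C := fun x hx => abs_le.1 (hC x hx)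
  have hac2 : AbsolutelyContinuousOnInterval (fun s => Real.exp (2 * m s) / 2) 0 T :=
    hac.of_dist_le (C := M) fun x hx y hy => hM.dist_le_mul _ (hmem x hx) _ (hmem y hy)
  have hcont : ContinuousOn (fun s => Real.exp (2 * m s)) (uIcc 0 T) :=
    (continuousOn_const.mul hac.continuousOn).rexp
  rw [hac2.integral_eq_sub_of_ae_hasDerivAt (hk.mul_continuousOn hcont)]
  · simp [hm]
    ring
  · filter_upwards [hk.ae_hasDerivAt_integral] with x h hx
    refine (((h hx 0 left_mem_uIcc).const_mul 2).exp.div_const 2).congr_deriv ?_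
    simp only [hm]
    ring

/-- **Gronwall's inequality** with an integrable coefficient (and a non-optimal constant). -/
theorem gronwall_integral {k u : ℝ → ℝ} {T c : ℝ} (hT : 0 ≤ T) (hc : 0 ≤ c)
    (hk : IntervalIntegrable k volume 0 T) (hk0 : ∀ t ∈ Icc 0 T, 0 ≤ k t)
    (hu : ContinuousOn u (Icc 0 T))
    (h : ∀ t ∈ Icc 0 T, u t ≤ c + ∫ s in (0 : ℝ)..t, k s * u s) :
    ∀ t ∈ Icc 0 T, u t ≤ 2 * c * Real.exp (2 * ∫ s in (0 : ℝ)..t, k s) := by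
  set m : ℝ → ℝ := fun s => ∫ r in (0 : ℝ)..s, k r with hm
  have hmc : ContinuousOn m (Icc 0 T) := by
    simpa [uIcc_of_le hT] using hk.absolutelyContinuousOnInterval_integral.continuousOn
  have hsub : ∀ t ∈ Icc 0 T, IntervalIntegrable k volume 0 t := fun t ht =>
    hk.mono_set (by rw [uIcc_of_le hT, uIcc_of_le ht.1]; exact Icc_subset_Icc_right ht.2)
  have hm0 : ∀ t ∈ Icc 0 T, 0 ≤ m t := fun t ht =>
    intervalIntegral.integral_nonneg ht.1 fun s hs => hk0 s ⟨hs.1, hs.2.trans ht.2⟩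
  have hw : ContinuousOn (fun t => Real.exp (2 * m t)) (Icc 0 T) :=
    (continuousOn_const.mul hmc).rexp
  have hv : ContinuousOn (fun t => u t / Real.exp (2 * m t)) (Icc 0 T) :=
    hu.div hw fun t _ => (Real.exp_pos _).ne'
  obtain ⟨t₀, ht₀, hmax⟩ := isCompact_Icc.exists_isMaxOn (nonempty_Icc.2 hT) hv
  set M := u t₀ / Real.exp (2 * m t₀) with hM
  have hMle : ∀ t ∈ Icc 0 T, u t ≤ M * Real.exp (2 * m t) := fun t ht => by
    have := hmax ht
    exact (div_le_iff₀ (Real.exp_pos _)).1 this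
  -- At the maximum point the hypothesis becomes `M * E ≤ c + M * (E - 1) / 2` with `E = exp (2 * m
  -- t₀) ≥ 1`.
  have key : M ≤ 2 * c := by
    have h1 := h t₀ ht₀
    have hI := hsub t₀ ht₀
    have hss : Icc 0 t₀ ⊆ Icc 0 T := Icc_subset_Icc_right ht₀.2
    have h2 : ∫ s in (0 : ℝ)..t₀, k s * u s
        ≤ ∫ s in (0 : ℝ)..t₀, M * (k s * Real.exp (2 * m s)) := by
      refine intervalIntegral.integral_mono_on ht₀.1 ?_ ?_ fun s hs => ?_
      · exact hI.mul_continuousOn (by rw [uIcc_of_le ht₀.1]; exact hu.mono hss)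
      · exact (hI.mul_continuousOn (by rw [uIcc_of_le ht₀.1]; exact hw.mono hss)).const_mul M
      · have := mul_le_mul_of_nonneg_left (hMle s (hss hs)) (hk0 s (hss hs))
        linarith
    rw [intervalIntegral.integral_const_mul, integral_mul_exp_integral hI] at h2
    have h3 : u t₀ = M * Real.exp (2 * m t₀) := by
      rw [hM, div_mul_cancel₀ _ (Real.exp_pos _).ne']
    have hE : 1 ≤ Real.exp (2 * m t₀) := Real.one_le_exp (by linarith [hm0 t₀ ht₀])
    change _ ≤ M * ((Real.exp (2 * m t₀) - 1) / 2) at h2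
    by_contra hcon
    push Not at hcon
    rw [h3] at h1
    nlinarith [mul_nonneg (hc.trans (by linarith : c ≤ M)) (sub_nonneg.2 hE)]
  intro t ht
  exact (hMle t ht).trans (by gcongr)

end Gronwall

/-! ### Linear Volterra equations in a Banach algebra, and invariant cones. -/

section LinearEquation

open scoped BoundedContinuousFunction

theorem continuousOn_Ici_of_Icc {X : Type*} [TopologicalSpace X] {f : ℝ → X}
    (h : ∀ T, 0 ≤ T → ContinuousOn f (Icc 0 T)) : ContinuousOn f (Ici 0) := by
  intro t ht
  have ht' : (0 : ℝ) ≤ t := ht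
  refine (h (t + 1) (by linarith) t ⟨ht', by linarith⟩).mono_of_mem_nhdsWithin ?_
  rw [← Ici_inter_Iic]
  exact inter_mem self_mem_nhdsWithin (mem_nhdsWithin_of_mem_nhds (Iic_mem_nhds (by linarith)))

theorem continuousOn_integral_Ici {E : Type*} [NormedAddCommGroup E] [NormedSpace ℝ E] {f : ℝ → E}
    (hf : ∀ T, 0 ≤ T → IntervalIntegrable f volume 0 T) :
    ContinuousOn (fun t => ∫ s in (0 : ℝ)..t, f s) (Ici 0) :=
  continuousOn_Ici_of_Icc fun T hT => by
    simpa [uIcc_of_le hT] using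
      (hf T hT).absolutelyContinuousOnInterval_integral.continuousOn

theorem IntervalIntegrable.mul_continuousOn_Ici {R : Type*} [NormedRing R] {K Φ : ℝ → R} {T : ℝ} (hT : 0 ≤ T)
    (hK : IntervalIntegrable K volume 0 T) (hΦ : ContinuousOn Φ (Ici 0)) :
    IntervalIntegrable (fun s => K s * Φ s) volume 0 T :=
  hK.mul_continuousOn (hΦ.mono fun x hx => by rw [uIcc_of_le hT] at hx; exact hx.1)

variable {R : Type*} [NormedRing R] [NormedAlgebra ℝ R]

/-- A closed convex cone that is also a submonoid of the algebra. -/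
structure IsClosedMulCone (C : Set R) : Prop where
  isClosed : IsClosed C
  one_mem : 1 ∈ C
  add_mem : ∀ {x y}, x ∈ C → y ∈ C → x + y ∈ C
  smul_mem : ∀ {c : ℝ} {x}, 0 ≤ c → x ∈ C → c • x ∈ C
  mul_mem : ∀ {x y}, x ∈ C → y ∈ C → x * y ∈ C

theorem isClosedMulCone_univ : IsClosedMulCone (univ : Set R) := by
  constructor <;> simp

theorem IsClosedMulCone.convex {C : Set R} (hC : IsClosedMulCone C) : Convex ℝ C :=
  fun _ hx _ hy _ _ ha hb _ => hC.add_mem (hC.smul_mem ha hx) (hC.smul_mem hb hy)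

/-- The defect `c` gives three uses: `c = 0` is uniqueness, `c = ‖1‖` an a priori bound, small `c`
stability. -/
theorem norm_le_of_eq_add_integral {K : ℝ → R} {T c : ℝ} {D : ℝ → R} (hc : 0 ≤ c)
    (hT : 0 ≤ T) (hK : IntervalIntegrable K volume 0 T) (hD : ContinuousOn D (Icc 0 T))
    (h : ∀ t ∈ Icc 0 T, ‖D t - ∫ s in (0 : ℝ)..t, K s * D s‖ ≤ c) :
    ∀ t ∈ Icc 0 T, ‖D t‖ ≤ 2 * c * Real.exp (2 * ∫ s in (0 : ℝ)..t, ‖K s‖) := by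
  refine gronwall_integral hT hc hK.norm (fun _ _ => norm_nonneg _) hD.norm fun t ht => ?_
  have hsub : uIcc 0 t ⊆ Icc 0 T := by rw [uIcc_of_le ht.1]; exact Icc_subset_Icc_right ht.2
  have hKt : IntervalIntegrable K volume 0 t := hK.mono_set (by rwa [uIcc_of_le hT])
  calc ‖D t‖ ≤ ‖D t - ∫ s in (0 : ℝ)..t, K s * D s‖ + ‖∫ s in (0 : ℝ)..t, K s * D s‖ := by
        simpa using norm_add_le (D t - ∫ s in (0 : ℝ)..t, K s * D s) (∫ s in (0 : ℝ)..t, K s * D s)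
    _ ≤ c + ∫ s in (0 : ℝ)..t, ‖K s‖ * ‖D s‖ := by
        gcongr
        · exact h t ht
        · exact intervalIntegral.norm_integral_le_of_norm_le ht.1
            (ae_of_all _ fun s _ => norm_mul_le _ _)
            (hKt.norm.mul_continuousOn (hD.norm.mono hsub))

variable [CompleteSpace R]

/-- The integral is `t` times an average, and averages stay in a closed convex set. -/
theorem IsClosedMulCone.integral_mem {C : Set R} (hC : IsClosedMulCone C) {f : ℝ → R} {t : ℝ}
    (ht : 0 ≤ t) (hf : IntervalIntegrable f volume 0 t) (h : ∀ s, 0 ≤ s → f s ∈ C) :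
    ∫ s in (0 : ℝ)..t, f s ∈ C := by
  rcases ht.eq_or_lt with rfl | ht0
  · simpa using hC.smul_mem (c := 0) le_rfl hC.one_mem
  have hav : (⨍ s in Ioc 0 t, f s) ∈ C := by
    refine hC.convex.set_average_mem hC.isClosed ?_ ?_ ?_
      ((intervalIntegrable_iff_integrableOn_Ioc_of_le ht).1 hf)
    · simpa using ht0
    · simp
    · exact (ae_restrict_mem measurableSet_Ioc).mono fun s hs => h s hs.1.le
  have := hC.smul_mem ht hav
  rw [setAverage_eq, smul_smul] at this
  rw [intervalIntegral.integral_of_le ht]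
  simpa [measureReal_def, ht, mul_inv_cancel₀ ht0.ne'] using this

/-- Existence for the linear Volterra equation with locally integrable coefficient; the solution
stays in every closed multiplicative convex cone that contains the coefficient. -/
theorem exists_linear_solution {K : ℝ → R} (hK : LocallyIntegrableOn K (Ici (0 : ℝ)))
    {C : Set R} (hC : IsClosedMulCone C) (hKC : ∀ t, 0 ≤ t → K t ∈ C) :
    ∃ Φ : ℝ → R, ContinuousOn Φ (Ici 0) ∧
      (∀ t, 0 ≤ t → Φ t = 1 + ∫ s in (0 : ℝ)..t, K s * Φ s) ∧ ∀ t, 0 ≤ t → Φ t ∈ C := by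
  set m : ℝ → ℝ := fun t => ∫ s in (0 : ℝ)..t, ‖K s‖ with hm
  have hKi : ∀ t, 0 ≤ t → IntervalIntegrable K volume 0 t := fun t ht =>
    hK.intervalIntegrable_of_nonneg le_rfl ht
  have hmc : ContinuousOn m (Ici 0) := continuousOn_integral_Ici fun T hT => (hKi T hT).norm
  have hm0 : ∀ t, 0 ≤ t → 0 ≤ m t := fun t ht =>
    intervalIntegral.integral_nonneg ht fun s _ => norm_nonneg _
  have hwc : ContinuousOn (fun t => Real.exp (2 * m t)) (Ici 0) :=
    (continuousOn_const.mul hmc).rexp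
  have hint : ∀ (y : ℝ →ᵇ R) t, 0 ≤ t →
      IntervalIntegrable (fun s => K s * (Real.exp (2 * m s) • y s)) volume 0 t := fun y t ht =>
    (hKi t ht).mul_continuousOn_Ici ht (hwc.smul y.continuous.continuousOn)
  have hbd : ∀ (y : ℝ →ᵇ R) t, 0 ≤ t →
      ‖∫ s in (0 : ℝ)..t, K s * (Real.exp (2 * m s) • y s)‖
        ≤ ‖y‖ * ((Real.exp (2 * m t) - 1) / 2) := fun y t ht => by
    rw [← integral_mul_exp_integral (hKi t ht).norm, ← intervalIntegral.integral_const_mul]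
    refine intervalIntegral.norm_integral_le_of_norm_le ht (ae_of_all _ fun s hs => ?_)
      (((hKi t ht).norm.mul_continuousOn (hwc.mono fun x hx => ?_)).const_mul _)
    · calc ‖K s * (Real.exp (2 * m s) • y s)‖ ≤ ‖K s‖ * ‖Real.exp (2 * m s) • y s‖ :=
            norm_mul_le _ _
        _ = ‖K s‖ * (Real.exp (2 * m s) * ‖y s‖) := by
            rw [norm_smul, Real.norm_eq_abs, abs_of_pos (Real.exp_pos _)]
        _ ≤ ‖K s‖ * (Real.exp (2 * m s) * ‖y‖) := by gcongr; exact y.norm_coe_le_norm s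
        _ = _ := by simp only [hm]; ring
    · rw [uIcc_of_le ht] at hx
      exact hx.1
  -- The Picard map for `y = exp (-2 * m) • Φ`; this weight makes it a 1/2-contraction on the whole
  -- half-line at once.
  set G : (ℝ →ᵇ R) → ℝ → R := fun y t => Real.exp (-(2 * m t)) •
    (1 + ∫ s in (0 : ℝ)..t, K s * (Real.exp (2 * m s) • y s)) with hG
  have hGc : ∀ y, Continuous fun t => G y (max t 0) := fun y => by
    have : ContinuousOn (G y) (Ici 0) :=
      (continuousOn_const.mul hmc).neg.rexp.smul
        (continuousOn_const.add (continuousOn_integral_Ici (hint y)))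
    exact this.comp_continuous (by fun_prop) fun t => mem_Ici.2 (le_max_right _ _)
  have hexp : ∀ t, 0 ≤ t → ∀ a : ℝ, 0 ≤ a →
      Real.exp (-(2 * m t)) * (a * ((Real.exp (2 * m t) - 1) / 2)) ≤ a / 2 := fun t ht a ha => by
    have h1 : Real.exp (-(2 * m t)) * Real.exp (2 * m t) = 1 := by
      rw [← Real.exp_add]; simp
    have h2 := Real.exp_pos (-(2 * m t))
    nlinarith
  have hGb : ∀ y t, ‖G y (max t 0)‖ ≤ ‖(1 : R)‖ + ‖y‖ / 2 := fun y t => by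
    have ht := le_max_right t 0
    have h1 : Real.exp (-(2 * m (max t 0))) ≤ 1 := by
      rw [Real.exp_le_one_iff]; linarith [hm0 _ ht]
    rw [hG]
    dsimp only
    rw [norm_smul, Real.norm_eq_abs, abs_of_pos (Real.exp_pos _)]
    calc _ ≤ Real.exp (-(2 * m (max t 0))) *
          (‖(1 : R)‖ + ‖y‖ * ((Real.exp (2 * m (max t 0)) - 1) / 2)) := by
          gcongr
          exact (norm_add_le _ _).trans (by gcongr; exact hbd y _ ht)
      _ ≤ 1 * ‖(1 : R)‖ + ‖y‖ / 2 := by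
          rw [mul_add]
          gcongr
          exact hexp _ ht _ (norm_nonneg _)
      _ = _ := by ring
  -- `max t 0` extends the values to negative times by a constant.
  set F : (ℝ →ᵇ R) → (ℝ →ᵇ R) := fun y =>
    BoundedContinuousFunction.ofNormedAddCommGroup _ (hGc y) _ (hGb y) with hF
  have hFapp : ∀ y t, F y t = G y (max t 0) := fun _ _ => rfl
  have hFc : ContractingWith (1 / 2) F := by
    refine ⟨by norm_num, LipschitzWith.of_dist_le_mul fun y z => ?_⟩
    rw [dist_eq_norm y z, BoundedContinuousFunction.dist_le (by positivity)]
    intro t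
    have ht := le_max_right t 0
    have hsub : G y (max t 0) - G z (max t 0) = Real.exp (-(2 * m (max t 0))) •
        ∫ s in (0 : ℝ)..(max t 0), K s * (Real.exp (2 * m s) • (y - z) s) := by
      simp only [hG, ← smul_sub, add_sub_add_left_eq_sub]
      rw [← intervalIntegral.integral_sub (hint y _ ht) (hint z _ ht)]
      simp only [BoundedContinuousFunction.coe_sub, Pi.sub_apply, smul_sub, mul_sub]
    rw [hFapp, hFapp, dist_eq_norm, hsub, norm_smul, Real.norm_eq_abs,
      abs_of_pos (Real.exp_pos _)]
    calc _ ≤ _ := mul_le_mul_of_nonneg_left (hbd (y - z) _ ht) (Real.exp_pos _).le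
      _ ≤ _ := hexp _ ht _ (norm_nonneg _)
      _ = _ := by simp; ring
  have hclosed : IsClosed {y : ℝ →ᵇ R | ∀ t, y t ∈ C} := by
    simp only [ofPred_forall]
    exact isClosed_iInter fun t =>
      hC.isClosed.preimage (continuous_eval_const t)
  have hmaps : MapsTo F {y : ℝ →ᵇ R | ∀ t, y t ∈ C} {y : ℝ →ᵇ R | ∀ t, y t ∈ C} := by
    intro y hy t
    have ht := le_max_right t 0
    exact hC.smul_mem (Real.exp_pos _).le (hC.add_mem hC.one_mem
      (hC.integral_mem ht (hint y _ ht) fun s hs =>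
        hC.mul_mem (hKC s hs) (hC.smul_mem (Real.exp_pos _).le (hy s))))
  obtain ⟨y, hyC, hyF, -⟩ := ContractingWith.exists_fixedPoint' hclosed.isComplete hmaps
    (hFc.restrict hmaps) (x := BoundedContinuousFunction.const ℝ (1 : R)) (fun _ => hC.one_mem)
    (edist_ne_top _ _)
  refine ⟨fun t => Real.exp (2 * m t) • y t, hwc.smul y.continuous.continuousOn, fun t ht => ?_,
    fun t _ => hC.smul_mem (Real.exp_pos _).le (hyC t)⟩
  have : y t = G y t := by
    conv_lhs => rw [← hyF, hFapp, max_eq_left ht]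
  dsimp only
  rw [this]
  simp only [hG, smul_smul]
  rw [← Real.exp_add, add_neg_cancel, Real.exp_zero, one_smul]

end LinearEquation

/-! ### Stability in the coefficient, and solutions that stay in a cone. -/

section Invariance

variable {R : Type*} [NormedRing R] [NormedAlgebra ℝ R]

/-- The difference solves the `K'` equation with forcing `∫ (K' - K) * Φ`. -/
theorem norm_sub_le_of_linear_solutions {K K' Φ Φ' : ℝ → R} {T B : ℝ} (hT : 0 ≤ T)
    (hK : IntervalIntegrable K volume 0 T) (hK' : IntervalIntegrable K' volume 0 T)
    (hΦ : ContinuousOn Φ (Icc 0 T)) (hΦ' : ContinuousOn Φ' (Icc 0 T))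
    (h : ∀ t ∈ Icc 0 T, Φ t = 1 + ∫ s in (0 : ℝ)..t, K s * Φ s)
    (h' : ∀ t ∈ Icc 0 T, Φ' t = 1 + ∫ s in (0 : ℝ)..t, K' s * Φ' s)
    (hB : ∀ t ∈ Icc 0 T, ‖Φ t‖ ≤ B) :
    ‖Φ' T - Φ T‖ ≤ 2 * ((∫ s in (0 : ℝ)..T, ‖K' s - K s‖) * B) *
      Real.exp (2 * ∫ s in (0 : ℝ)..T, ‖K' s‖) := by
  have hB0 : 0 ≤ B := (norm_nonneg _).trans (hB 0 ⟨le_rfl, hT⟩)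
  have hI0 : 0 ≤ ∫ s in (0 : ℝ)..T, ‖K' s - K s‖ :=
    intervalIntegral.integral_nonneg hT fun _ _ => norm_nonneg _
  refine norm_le_of_eq_add_integral (K := K') (D := fun t => Φ' t - Φ t) (by positivity) hT hK'
    (hΦ'.sub hΦ) (fun t ht => ?_) T ⟨hT, le_rfl⟩
  have hsub : uIcc 0 t ⊆ Icc 0 T := by rw [uIcc_of_le ht.1]; exact Icc_subset_Icc_right ht.2
  have hKt : IntervalIntegrable K volume 0 t := hK.mono_set (by rwa [uIcc_of_le hT])
  have hKt' : IntervalIntegrable K' volume 0 t := hK'.mono_set (by rwa [uIcc_of_le hT])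
  have e1 := hKt.mul_continuousOn (hΦ.mono hsub)
  have e2 := hKt'.mul_continuousOn (hΦ'.mono hsub)
  have e3 := hKt'.mul_continuousOn (hΦ.mono hsub)
  have heq : Φ' t - Φ t - ∫ s in (0 : ℝ)..t, K' s * (Φ' s - Φ s)
      = ∫ s in (0 : ℝ)..t, (K' s - K s) * Φ s := by
    simp only [mul_sub, sub_mul]
    rw [intervalIntegral.integral_sub e2 e3, intervalIntegral.integral_sub e3 e1, h t ht, h' t ht]
    abel
  rw [heq]
  calc ‖∫ s in (0 : ℝ)..t, (K' s - K s) * Φ s‖ ≤ ∫ s in (0 : ℝ)..t, ‖K' s - K s‖ * B := by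
        refine intervalIntegral.norm_integral_le_of_norm_le ht.1 (ae_of_all _ fun s hs => ?_)
          ((hKt'.sub hKt).norm.mul_const B)
        refine (norm_mul_le _ _).trans ?_
        gcongr
        exact hB s ⟨hs.1.le, hs.2.trans ht.2⟩
    _ = (∫ s in (0 : ℝ)..t, ‖K' s - K s‖) * B := intervalIntegral.integral_mul_const _ _
    _ ≤ _ := by
        gcongr
        exact intervalIntegral.integral_mono_interval le_rfl ht.1 ht.2
          (ae_of_all _ fun _ => norm_nonneg _) (hK'.sub hK).norm

/-- The elements whose sum with a multiple of the unit is in `C`. -/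
def shiftedCone (C : Set R) : Set R := {A | ∃ c : ℝ, A + c • (1 : R) ∈ C}

theorem IsClosedMulCone.add_smul_one_mem {C : Set R} (hC : IsClosedMulCone C) {A : R} {c d : ℝ}
    (h : A + c • (1 : R) ∈ C) (hcd : c ≤ d) : A + d • (1 : R) ∈ C := by
  have := hC.add_mem h (hC.smul_mem (sub_nonneg.2 hcd) hC.one_mem)
  rwa [add_assoc, ← add_smul, add_sub_cancel] at this

theorem IsClosedMulCone.zero_mem_shiftedCone {C : Set R} (hC : IsClosedMulCone C) :
    (0 : R) ∈ shiftedCone C := ⟨1, by simpa using hC.one_mem⟩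

theorem IsClosedMulCone.smul_mem_closure_shiftedCone {C : Set R} (hC : IsClosedMulCone C) {A : R}
    {a : ℝ} (ha : 0 ≤ a) (hA : A ∈ closure (shiftedCone C)) :
    a • A ∈ closure (shiftedCone C) := by
  refine map_mem_closure (continuous_const_smul a) hA fun B ⟨c, hc⟩ => ⟨a * c, ?_⟩
  simpa [smul_smul] using hC.smul_mem ha hc

variable [CompleteSpace R]

/-- Adding `c • 1` to the coefficient multiplies the solution by `exp (c * t)`, and a positive
factor does not leave the cone. -/
theorem exists_linear_solution_of_add_smul_one_mem {C : Set R} (hC : IsClosedMulCone C)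
    {K : ℝ → R} (hK : LocallyIntegrableOn K (Ici (0 : ℝ))) {c : ℝ}
    (h : ∀ t, 0 ≤ t → K t + c • (1 : R) ∈ C) :
    ∃ Φ : ℝ → R, ContinuousOn Φ (Ici 0) ∧
      (∀ t, 0 ≤ t → Φ t = 1 + ∫ s in (0 : ℝ)..t, K s * Φ s) ∧ ∀ t, 0 ≤ t → Φ t ∈ C := by
  set Q : ℝ → R := fun t => K t + c • (1 : R) with hQdef
  have hQ : LocallyIntegrableOn Q (Ici (0 : ℝ)) := hK.add (locallyIntegrableOn_const _)
  obtain ⟨Ψ, hΨc, hΨ, hΨC⟩ := exists_linear_solution hQ hC h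
  have he : ContDiff ℝ 1 fun t : ℝ => Real.exp (-(c * t)) := by fun_prop
  refine ⟨fun t => Real.exp (-(c * t)) • Ψ t, he.continuous.continuousOn.smul hΨc, fun t ht => ?_,
    fun t ht => hC.smul_mem (Real.exp_pos _).le (hΨC t ht)⟩
  have hΦc : ContinuousOn (fun t => Real.exp (-(c * t)) • Ψ t) (Ici 0) :=
    he.continuous.continuousOn.smul hΨc
  have hQΨ := (hQ.intervalIntegrable_of_nonneg le_rfl ht).mul_continuousOn_Ici ht hΨc
  have hac : AbsolutelyContinuousOnInterval
      (fun t => Real.exp (-(c * t)) • (1 + ∫ s in (0 : ℝ)..t, Q s * Ψ s)) 0 t :=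
    he.contDiffOn.absolutelyContinuousOnInterval.fun_smul
      (hQΨ.absolutelyContinuousOnInterval_integral.of_dist_le (C := 1) fun x _ y _ => by simp)
  have := hac.integral_eq_sub_of_ae_hasDerivAt
    (((hK.intervalIntegrable_of_nonneg le_rfl ht).mul_continuousOn_Ici ht hΦc)) (by
      filter_upwards [hQΨ.ae_hasDerivAt_integral] with x hx hxt
      have h1 := (hx hxt 0 left_mem_uIcc).const_add 1
      have h2 : HasDerivAt (fun t : ℝ => Real.exp (-(c * t))) (Real.exp (-(c * x)) * -c) x := by
        simpa using (((hasDerivAt_id x).const_mul c).neg).exp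
      have hx0 : 0 ≤ x := by rw [uIcc_of_le ht] at hxt; exact hxt.1
      refine (h2.fun_smul h1).congr_deriv ?_
      rw [← hΨ x hx0, hQdef]
      simp only [add_mul, smul_mul_assoc, one_mul, smul_add, mul_smul_comm, smul_smul, mul_neg,
        neg_smul]
      abel)
  dsimp only
  rw [this, hΨ t ht]
  simp

/-- Approximation in `L¹` by simple functions with values in a set whose closure contains almost
all values. -/
theorem exists_simpleFunc_integral_norm_sub_le {α E : Type*} [MeasurableSpace α]
    [NormedAddCommGroup E] [NormedSpace ℝ E]
    {μ : Measure α} [IsFiniteMeasure μ] {K : α → E} (hK : Integrable K μ) {S : Set E}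
    (h0 : (0 : E) ∈ S) (h : ∀ᵐ x ∂μ, K x ∈ closure S) {ε : ℝ} (hε : 0 < ε) :
    ∃ g : SimpleFunc α E, (∀ x, g x ∈ S) ∧ Integrable g μ ∧ ∫ x, ‖g x - K x‖ ∂μ ≤ ε := by
  borelize E
  obtain ⟨f, hfm, hKf⟩ := hK.aestronglyMeasurable
  have hf : Integrable f μ := hK.congr hKf
  -- `SimpleFunc.approxOn` needs a separable target set.
  set s : Set E := (range f ∪ {0}) ∩ closure S with hs
  have hs0 : (0 : E) ∈ s := ⟨by simp, subset_closure h0⟩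
  have : TopologicalSpace.SeparableSpace s :=
    ((hfm.isSeparable_range.union (finite_singleton 0).isSeparable).mono
      inter_subset_left).separableSpace
  have hfs : ∀ᵐ x ∂μ, f x ∈ closure s := by
    filter_upwards [h, hKf] with x hx hx'
    rw [hx'] at hx
    exact subset_closure ⟨by simp, hx⟩
  have hlim := SimpleFunc.tendsto_approxOn_L1_enorm (μ := μ) hfm.measurable hs0 hfs
    (by simpa using hf.2)
  obtain ⟨n, hn⟩ := ((ENNReal.tendsto_nhds_zero.1 hlim) (ENNReal.ofReal (ε / 2))
    (by simpa using hε)).exists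
  set g := SimpleFunc.approxOn f hfm.measurable s 0 hs0 n with hg
  have hgs : ∀ x, g x ∈ closure S := fun x => (SimpleFunc.approxOn_mem hfm.measurable hs0 n x).2
  set δ : ℝ := ε / 2 / (μ.real univ + 1) with hδ
  have hδ0 : 0 < δ := by positivity
  -- The approximants take values in `closure S`; each value is moved into `S`, at total cost at
  -- most `ε / 2`.
  have hφ : ∀ A : E, ∃ B ∈ S, A ∈ closure S → ‖B - A‖ ≤ δ := fun A => by
    by_cases hA : A ∈ closure S
    · obtain ⟨B, hB, hAB⟩ := Metric.mem_closure_iff.1 hA δ hδ0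
      exact ⟨B, hB, fun _ => by rw [← dist_eq_norm, dist_comm]; exact hAB.le⟩
    · exact ⟨0, h0, fun h => absurd h hA⟩
  choose φ hφS hφd using hφ
  have hgi : Integrable g μ := SimpleFunc.integrable_of_isFiniteMeasure g
  have hgi' : Integrable (g.map φ) μ := SimpleFunc.integrable_of_isFiniteMeasure _
  refine ⟨g.map φ, fun x => hφS _, hgi', ?_⟩
  have e1 : ∫ x, ‖g x - f x‖ ∂μ ≤ ε / 2 := by
    refine (integral_norm_eq_lintegral_enorm (hgi.sub hf).aestronglyMeasurable).trans_le ?_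
    exact ENNReal.toReal_le_of_le_ofReal (by positivity) hn
  calc ∫ x, ‖g.map φ x - K x‖ ∂μ ≤ ∫ x, (δ + ‖g x - f x‖) ∂μ := by
        refine integral_mono_ae (hgi'.sub hK).norm
          ((integrable_const _).add (hgi.sub hf).norm) ?_
        filter_upwards [hKf] with x hx
        rw [hx]
        calc ‖g.map φ x - f x‖ ≤ ‖φ (g x) - g x‖ + ‖g x - f x‖ := by
              simpa using norm_sub_le_norm_sub_add_norm_sub (φ (g x)) (g x) (f x)
          _ ≤ _ := by gcongr; exact hφd _ (hgs x)
    _ = μ.real univ * δ + ∫ x, ‖g x - f x‖ ∂μ := by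
        refine (integral_add (integrable_const _) (hgi.sub hf).norm).trans ?_
        simp
    _ ≤ ε / 2 + ε / 2 := by
        gcongr
        rw [hδ, mul_div_assoc', div_le_iff₀ (by positivity)]
        nlinarith [measureReal_nonneg (μ := μ) (s := univ)]
    _ = ε := by ring

/-- Approximating the coefficient in `L¹` changes the solution little, and `C` is closed. -/
theorem linear_solution_mem_of_ae_mem_closure {C : Set R} (hC : IsClosedMulCone C)
    {K Φ : ℝ → R} (hK : LocallyIntegrableOn K (Ici (0 : ℝ)))
    (hKC : ∀ᵐ t, 0 ≤ t → K t ∈ closure (shiftedCone C)) (hΦc : ContinuousOn Φ (Ici 0))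
    (hΦ : ∀ t, 0 ≤ t → Φ t = 1 + ∫ s in (0 : ℝ)..t, K s * Φ s) {T : ℝ} (hT : 0 ≤ T) :
    Φ T ∈ C := by
  have hsub : Icc 0 T ⊆ Ici 0 := fun x hx => hx.1
  obtain ⟨B, hB⟩ := isCompact_Icc.exists_bound_of_continuousOn (hΦc.mono hsub)
  have hKi := hK.intervalIntegrable_of_nonneg le_rfl hT
  have key : ∀ ε : ℝ, 0 < ε → ∃ X ∈ C, ‖X - Φ T‖ ≤ 2 * (ε * B) *
      Real.exp (2 * ((∫ s in (0 : ℝ)..T, ‖K s‖) + ε)) := by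
    intro ε hε
    obtain ⟨g, hgS, hgi, hgε⟩ := exists_simpleFunc_integral_norm_sub_le
      (μ := volume.restrict (Ioc 0 T))
      ((intervalIntegrable_iff_integrableOn_Ioc_of_le hT).1 hKi) hC.zero_mem_shiftedCone
      ((ae_restrict_iff' measurableSet_Ioc).2
        (hKC.mono fun t ht hs => ht hs.1.le)) hε
    rw [← intervalIntegral.integral_of_le hT] at hgε
    choose c hc using hgS
    -- A simple function has finitely many values, so the largest of their shifts serves for all.
    obtain ⟨d, hd⟩ : ∃ d : ℝ, ∀ t, g t + d • (1 : R) ∈ C := by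
      have : ∀ A : R, ∃ c : ℝ, A ∈ g.range → A + c • (1 : R) ∈ C := fun A => by
        by_cases hA : A ∈ g.range
        · obtain ⟨x, rfl⟩ := SimpleFunc.mem_range.1 hA
          exact ⟨c x, fun _ => hc x⟩
        · exact ⟨0, fun h => absurd h hA⟩
      choose e he using this
      obtain ⟨d, hd⟩ := (g.range.image e).exists_le
      exact ⟨d, fun t => hC.add_smul_one_mem (he _ (g.mem_range_self t))
        (hd _ (Finset.mem_image_of_mem _ (g.mem_range_self t)))⟩
    have hgl : LocallyIntegrableOn g (Ici (0 : ℝ)) :=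
      (locallyIntegrable_iff.2 fun k hk => by
        have : IsFiniteMeasure (volume.restrict k) := ⟨by simpa using hk.measure_lt_top⟩
        exact SimpleFunc.integrable_of_isFiniteMeasure g).locallyIntegrableOn _
    obtain ⟨Ψ, hΨc, hΨ, hΨC⟩ := exists_linear_solution_of_add_smul_one_mem hC hgl
      (c := d) fun t _ => hd t
    have hgI := hgl.intervalIntegrable_of_nonneg le_rfl hT
    refine ⟨Ψ T, hΨC T hT, (norm_sub_le_of_linear_solutions hT hKi hgI (hΦc.mono hsub)
      (hΨc.mono hsub) (fun t ht => hΦ t ht.1) (fun t ht => hΨ t ht.1) hB).trans ?_⟩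
    have hB0 : 0 ≤ B := (norm_nonneg _).trans (hB 0 ⟨le_rfl, hT⟩)
    have hsum : ∫ s in (0 : ℝ)..T, ‖g s‖ ≤ (∫ s in (0 : ℝ)..T, ‖K s‖) + ε := by
      calc ∫ s in (0 : ℝ)..T, ‖g s‖ ≤ ∫ s in (0 : ℝ)..T, (‖K s‖ + ‖g s - K s‖) :=
            intervalIntegral.integral_mono_on hT hgI.norm (hKi.norm.add (hgI.sub hKi).norm)
              fun s _ => by simpa using norm_add_le (K s) (g s - K s)
        _ = (∫ s in (0 : ℝ)..T, ‖K s‖) + ∫ s in (0 : ℝ)..T, ‖g s - K s‖ :=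
            intervalIntegral.integral_add hKi.norm (hgI.sub hKi).norm
        _ ≤ _ := by gcongr
    gcongr
  have hlim : Tendsto (fun ε : ℝ => 2 * (ε * B) *
      Real.exp (2 * ((∫ s in (0 : ℝ)..T, ‖K s‖) + ε))) (𝓝[>] 0) (𝓝 0) := by
    have : Continuous fun ε : ℝ => 2 * (ε * B) *
      Real.exp (2 * ((∫ s in (0 : ℝ)..T, ‖K s‖) + ε)) := by fun_prop
    simpa using (this.tendsto 0).mono_left nhdsWithin_le_nhds
  rw [← hC.isClosed.closure_eq, Metric.mem_closure_iff]
  intro η hη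
  obtain ⟨ε, hε0, hε⟩ := ((eventually_mem_nhdsWithin (a := (0 : ℝ)) (s := Ioi 0)).and
    (hlim.eventually (gt_mem_nhds hη))).exists
  obtain ⟨X, hX, hXd⟩ := key ε hε0
  exact ⟨X, hX, by rw [dist_comm, dist_eq_norm]; exact hXd.trans_lt hε⟩

end Invariance

/-! ### Propagators, invertibility and tangent directions. -/

section Propagator

theorem intervalIntegral_indicator_Ioi {E : Type*} [NormedAddCommGroup E] [NormedSpace ℝ E]
    {F : ℝ → E} {a s : ℝ} (ha : 0 ≤ a) (hs : 0 ≤ s) :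
    ∫ r in (0 : ℝ)..s, (Ioi a).indicator F r = ∫ r in a..(max s a), F r := by
  rw [intervalIntegral.integral_of_le hs, setIntegral_indicator measurableSet_Ioi, Ioc_inter_Ioi,
    intervalIntegral.integral_of_le (le_max_right _ _), max_eq_right ha]
  rcases le_total s a with h | h
  · simp [h]
  · rw [max_eq_left h]

theorem MeasureTheory.LocallyIntegrableOn.indicator {E : Type*} [NormedAddCommGroup E] {K : ℝ → E}
    {s t : Set ℝ} (hK : LocallyIntegrableOn K s) (ht : MeasurableSet t) :
    LocallyIntegrableOn (t.indicator K) s := fun x hx => by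
  obtain ⟨U, hU, hi⟩ := hK x hx
  exact ⟨U, hU, hi.indicator ht⟩

variable {R : Type*} [NormedRing R] [NormedAlgebra ℝ R]

theorem norm_sub_one_le_of_linear_solution {K U : ℝ → R} {T : ℝ} (hT : 0 ≤ T)
    (hK : LocallyIntegrableOn K (Ici (0 : ℝ))) (hUc : ContinuousOn U (Ici 0))
    (hU : ∀ t, 0 ≤ t → U t = 1 + ∫ s in (0 : ℝ)..t, K s * U s) :
    ‖U T - 1‖ ≤ (∫ s in (0 : ℝ)..T, ‖K s‖) *
      (2 * ‖(1 : R)‖ * Real.exp (2 * ∫ s in (0 : ℝ)..T, ‖K s‖)) := by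
  have hKi := hK.intervalIntegrable_of_nonneg le_rfl hT
  have hb := norm_le_of_eq_add_integral (norm_nonneg (1 : R)) hT hKi
    (hUc.mono fun x hx => hx.1) fun t ht => by
      conv_lhs => rw [hU t ht.1, add_sub_cancel_right]
  have hU1 : U T - 1 = ∫ s in (0 : ℝ)..T, K s * U s := by rw [hU T hT, add_sub_cancel_left]
  rw [hU1, ← intervalIntegral.integral_mul_const]
  refine intervalIntegral.norm_integral_le_of_norm_le hT (ae_of_all _ fun s hs => ?_)
    (hKi.norm.mul_const _)
  refine (norm_mul_le _ _).trans ?_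
  gcongr
  refine (hb s ⟨hs.1.le, hs.2⟩).trans ?_
  gcongr
  exact intervalIntegral.integral_mono_interval le_rfl hs.1.le hs.2
    (ae_of_all _ fun _ => norm_nonneg _) hKi.norm

variable [CompleteSpace R]

/-- `U s * Φ a` and `Φ (max s a)` both solve the equation whose coefficient is cut off before `a`,
with initial value `Φ a`; uniqueness identifies them. -/
theorem linear_solution_eq_mul {K Φ U : ℝ → R} {a t : ℝ}
    (hK : LocallyIntegrableOn K (Ici (0 : ℝ))) (hΦc : ContinuousOn Φ (Ici 0))
    (hΦ : ∀ t, 0 ≤ t → Φ t = 1 + ∫ s in (0 : ℝ)..t, K s * Φ s)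
    (hUc : ContinuousOn U (Ici 0))
    (hU : ∀ t, 0 ≤ t → U t = 1 + ∫ s in (0 : ℝ)..t, (Ioi a).indicator K s * U s)
    (ha : 0 ≤ a) (hat : a ≤ t) : Φ t = U t * Φ a := by
  have hK' := hK.indicator (measurableSet_Ioi (a := a))
  have ht : 0 ≤ t := ha.trans hat
  have hc1 : ContinuousOn (fun s => U s * Φ a) (Ici 0) := hUc.mul continuousOn_const
  have hc2 : ContinuousOn (fun s => Φ (max s a)) (Ici 0) :=
    hΦc.comp (by fun_prop) fun s _ => mem_Ici.2 (ha.trans (le_max_right _ _))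
  have := norm_le_of_eq_add_integral (K := (Ioi a).indicator K)
    (D := fun s => U s * Φ a - Φ (max s a)) le_rfl ht
    (hK'.intervalIntegrable_of_nonneg le_rfl ht)
    ((hc1.sub hc2).mono fun x hx => hx.1) (fun s hs => ?_) t ⟨ht, le_rfl⟩
  · simpa [max_eq_left hat, sub_eq_zero, eq_comm] using this
  have hKs' := hK'.intervalIntegrable_of_nonneg le_rfl hs.1
  have e1 : ∫ r in (0 : ℝ)..s, (Ioi a).indicator K r * (U r * Φ a) = U s * Φ a - Φ a := by
    simp only [← mul_assoc]
    have := ((ContinuousLinearMap.mul ℝ R).flip (Φ a)).intervalIntegral_comp_comm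
      (hKs'.mul_continuousOn_Ici hs.1 hUc)
    simp only [ContinuousLinearMap.flip_apply, ContinuousLinearMap.mul_apply'] at this
    rw [this, hU s hs.1]
    noncomm_ring
  have e2 : ∫ r in (0 : ℝ)..s, (Ioi a).indicator K r * Φ (max r a) = Φ (max s a) - Φ a := by
    have hind : ∀ r, (Ioi a).indicator K r * Φ (max r a)
        = (Ioi a).indicator (fun r => K r * Φ r) r := fun r => by
      by_cases hr : a < r
      · simp [hr, hr.le]
      · simp [hr]
    have hi : ∀ b, 0 ≤ b → IntervalIntegrable (fun s => K s * Φ s) volume 0 b := fun b hb =>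
      (hK.intervalIntegrable_of_nonneg le_rfl hb).mul_continuousOn_Ici hb hΦc
    have hm : 0 ≤ max s a := ha.trans (le_max_right _ _)
    simp only [hind]
    rw [intervalIntegral_indicator_Ioi ha hs.1, hΦ _ hm, hΦ a ha, add_sub_add_left_eq_sub,
      intervalIntegral.integral_interval_sub_left (hi _ hm) (hi a ha)]
  simp only [mul_sub]
  rw [intervalIntegral.integral_sub (hKs'.mul_continuousOn_Ici hs.1 hc1)
    (hKs'.mul_continuousOn_Ici hs.1 hc2), e1, e2]
  simp

/-- Nonunits form a closed set, so there would be a first bad time `T > 0`. For `a` just below `T`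
the propagator from `a` to `T` is close to 1, hence a unit, and `Φ T` is its product with the unit
`Φ a`. -/
theorem isUnit_linear_solution {K Φ : ℝ → R} (hK : LocallyIntegrableOn K (Ici (0 : ℝ)))
    (hΦc : ContinuousOn Φ (Ici 0))
    (hΦ : ∀ t, 0 ≤ t → Φ t = 1 + ∫ s in (0 : ℝ)..t, K s * Φ s) {t : ℝ} (ht : 0 ≤ t) :
    IsUnit (Φ t) := by
  by_contra hnu
  set B : Set ℝ := Ici 0 ∩ Φ ⁻¹' nonunits R with hB
  have hBc : IsClosed B := hΦc.preimage_isClosed_of_isClosed isClosed_Ici nonunits.isClosed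
  have hbb : BddBelow B := ⟨0, fun x hx => hx.1⟩
  obtain ⟨hT, hTn⟩ : sInf B ∈ B := hBc.csInf_mem ⟨t, ht, hnu⟩ hbb
  set T := sInf B with hTdef
  have hunit : ∀ a, 0 ≤ a → a < T → IsUnit (Φ a) := fun a ha haT => by
    by_contra h
    exact (csInf_le hbb ⟨ha, h⟩).not_gt haT
  have hT0 : 0 < T := by
    refine lt_of_le_of_ne hT fun h => hTn ?_
    rw [← h, hΦ 0 le_rfl]
    simp
  have hKi : ∀ b, 0 ≤ b → IntervalIntegrable (fun s => ‖K s‖) volume 0 b := fun b hb =>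
    (hK.intervalIntegrable_of_nonneg le_rfl hb).norm
  have hlim : Tendsto (fun a => (∫ s in a..T, ‖K s‖) *
      (2 * ‖(1 : R)‖ * Real.exp (2 * ∫ s in a..T, ‖K s‖))) (𝓝[<] T) (𝓝 0) := by
    have h1 : Tendsto (fun a => ∫ s in (0 : ℝ)..a, ‖K s‖) (𝓝[<] T)
        (𝓝 (∫ s in (0 : ℝ)..T, ‖K s‖)) :=
      (((continuousOn_integral_Ici hKi) T hT).continuousAt (Ici_mem_nhds hT0)).tendsto.mono_left
        nhdsWithin_le_nhds
    have h2 : Tendsto (fun a => ∫ s in a..T, ‖K s‖) (𝓝[<] T) (𝓝 0) := by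
      have := (tendsto_const_nhds (x := ∫ s in (0 : ℝ)..T, ‖K s‖)).sub h1
      rw [sub_self] at this
      refine this.congr' ?_
      filter_upwards [Ioo_mem_nhdsLT hT0] with a ha
      exact intervalIntegral.integral_interval_sub_left (hKi T hT) (hKi a ha.1.le)
    simpa using h2.mul ((Real.continuous_exp.tendsto _).comp (h2.const_mul 2) |>.const_mul
      (2 * ‖(1 : R)‖))
  obtain ⟨a, ha, haT⟩ := ((Filter.eventually_mem_set.2 (Ioo_mem_nhdsLT hT0)).and
    (hlim.eventually (gt_mem_nhds one_pos))).exists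
  have hK' := hK.indicator (measurableSet_Ioi (a := a))
  obtain ⟨U, hUc, hU, -⟩ := exists_linear_solution hK' isClosedMulCone_univ fun _ _ => mem_univ _
  have hnorm : ∫ s in (0 : ℝ)..T, ‖(Ioi a).indicator K s‖ = ∫ s in a..T, ‖K s‖ := by
    simp only [norm_indicator_eq_indicator_norm]
    rw [intervalIntegral_indicator_Ioi ha.1.le hT, max_eq_left ha.2.le]
  have hlt := norm_sub_one_le_of_linear_solution hT hK' hUc hU
  rw [hnorm] at hlt
  have hUT : IsUnit (U T) := by
    have := (Units.oneSub (1 - U T) (by rw [norm_sub_rev]; exact hlt.trans_lt haT)).isUnit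
    simpa using this
  refine hTn ?_
  rw [linear_solution_eq_mul hK hΦc hΦ hUc hU ha.1.le ha.2.le]
  exact hUT.mul (hunit a ha.1.le ha.2)

/-- If the increments of the solution factor through a cone, then almost every value of the
coefficient is a tangent direction to the cone at the unit. -/
theorem ae_mem_closure_shiftedCone {C : Set R} (hC : IsClosedMulCone C) {K Φ : ℝ → R}
    (hK : LocallyIntegrableOn K (Ici (0 : ℝ))) (hΦc : ContinuousOn Φ (Ici 0))
    (hΦ : ∀ t, 0 ≤ t → Φ t = 1 + ∫ s in (0 : ℝ)..t, K s * Φ s)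
    (h : ∀ a t, 0 ≤ a → a < t → ∃ V ∈ C, Φ t = V * Φ a) :
    ∀ᵐ t, 0 ≤ t → K t ∈ closure (shiftedCone C) := by
  have hd : ∀ᵐ x, ∀ n : ℕ, x ∈ uIcc (0 : ℝ) n → ∀ c ∈ uIcc (0 : ℝ) n,
      HasDerivAt (fun x => ∫ t in c..x, K t * Φ t) (K x * Φ x) x :=
    ae_all_iff.2 fun n => ((hK.intervalIntegrable_of_nonneg le_rfl n.cast_nonneg
      ).mul_continuousOn_Ici n.cast_nonneg hΦc).ae_hasDerivAt_integral
  filter_upwards [hd] with x hx hx0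
  obtain ⟨n, hn⟩ := exists_nat_ge x
  have hder := (hx n (by rw [uIcc_of_le n.cast_nonneg]; exact ⟨hx0, hn⟩) 0
    left_mem_uIcc).tendsto_slope_zero_right
  obtain ⟨u, hu⟩ := isUnit_linear_solution hK hΦc hΦ hx0
  have hlim := hder.mul_const (↑u⁻¹ : R)
  rw [← hu, mul_assoc, u.mul_inv, mul_one] at hlim
  refine mem_closure_of_tendsto hlim ?_
  filter_upwards [self_mem_nhdsWithin] with r hr
  have hr0 : (0 : ℝ) < r := hr
  obtain ⟨V, hV, hVΦ⟩ := h x (x + r) hx0 (by linarith)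
  have e : (∫ t in (0 : ℝ)..(x + r), K t * Φ t) - ∫ t in (0 : ℝ)..x, K t * Φ t
      = (V - 1) * u := by
    rw [sub_mul, one_mul, hu, ← hVΦ, hΦ _ (by linarith : 0 ≤ x + r), hΦ x hx0,
      add_sub_add_left_eq_sub]
  -- The shift `r⁻¹` turns `(V - 1) / r` into `V / r`.
  refine ⟨r⁻¹, ?_⟩
  rw [e, smul_mul_assoc, mul_assoc, u.mul_inv, mul_one, ← smul_add, sub_add_cancel]
  exact hC.smul_mem (inv_pos.2 hr0).le hV

end Propagator

/-! ### Completely positive maps as a closed multiplicative cone. -/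

section CompletelyPositive

theorem exists_isDynamicalMap {A : Type*} [NormedAddCommGroup A] [NormedSpace ℂ A] [CompleteSpace A]
    {L : ℝ → SuperOp A} (hL : NonSingular L) :
    ∃ Φ, IsDynamicalMap L Φ :=
  let ⟨Φ, hc, h, _⟩ := exists_linear_solution hL isClosedMulCone_univ fun _ _ => mem_univ _
  ⟨Φ, hc, h⟩

variable {A : Type*} [CStarAlgebra A] [PartialOrder A] [StarOrderedRing A]

theorem isCP_iff {Ψ : SuperOp A} :
    IsCP Ψ ↔ ∀ (k : ℕ) (M : CStarMatrix (Fin k) (Fin k) A), 0 ≤ M → 0 ≤ M.map Ψ := by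
  constructor
  · rintro ⟨F, hF⟩ k M hM
    have : (F : A → A) = Ψ := funext hF
    rw [← this]
    exact F.map_cstarMatrix_nonneg' k M hM
  · intro h
    exact ⟨{ (Ψ : A →ₗ[ℂ] A) with map_cstarMatrix_nonneg' := h }, fun _ => rfl⟩

theorem isClosedMulCone_isCP : IsClosedMulCone {Ψ : SuperOp A | IsCP Ψ} where
  isClosed := by
    simp only [isCP_iff, ofPred_forall]
    refine isClosed_iInter fun k => isClosed_iInter fun M => isClosed_iInter fun _ => ?_
    -- Closedness holds one matrix `M` at a time: the topology of `CStarMatrix` is entrywise and its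
    -- positive cone is closed.
    have hc : Continuous fun Ψ : SuperOp A => CStarMatrix.ofMatrixL (M.map Ψ) := by
      refine CStarMatrix.ofMatrixL.continuous.comp (continuous_matrix fun i j => ?_)
      exact (ContinuousLinearMap.apply ℂ A (M i j)).continuous
    exact isClosed_Ici.preimage hc
  one_mem := isCP_iff.2 fun _ _ hM => hM
  add_mem hx hy := isCP_iff.2 fun k M hM =>
    add_nonneg (isCP_iff.1 hx k M hM) (isCP_iff.1 hy k M hM)
  smul_mem {c x} hc hx := isCP_iff.2 fun k M hM => by
    have := smul_nonneg hc (isCP_iff.1 hx k M hM)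
    exact this
  mul_mem hx hy := isCP_iff.2 fun k M hM => isCP_iff.1 hx k _ (isCP_iff.1 hy k M hM)

theorem IsDynamicalMap.isCP_of_cpDivisible {L Φ Φ' : ℝ → SuperOp A} (hL : NonSingular L)
    (hΦ : IsDynamicalMap L Φ) (hdiv : CPDivisible Φ) {α : ℝ → ℝ} (hα : ∀ t, 0 ≤ t → 0 ≤ α t)
    (hαL : NonSingular fun t => α t • L t) (hΦ' : IsDynamicalMap (fun t => α t • L t) Φ')
    {t : ℝ} (ht : 0 ≤ t) : IsCP (Φ' t) := by
  refine linear_solution_mem_of_ae_mem_closure isClosedMulCone_isCP hαL ?_ hΦ'.1 hΦ'.2 ht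
  filter_upwards [ae_mem_closure_shiftedCone isClosedMulCone_isCP hL hΦ.1 hΦ.2 hdiv] with s hs hs0
  exact isClosedMulCone_isCP.smul_mem_closure_shiftedCone (hα s hs0) (hs hs0)

theorem isTimeStretching_indicator (a : ℝ) : IsTimeStretching ((Ioi a).indicator 1) :=
  ⟨fun _ _ => indicator_nonneg (fun _ _ => zero_le_one) _,
    LocallyIntegrableOn.indicator (locallyIntegrableOn_const (1 : ℝ)) measurableSet_Ioi⟩

end CompletelyPositive

theorem theorem1 {H : Type*} [NormedAddCommGroup H] [InnerProductSpace ℂ H] [CompleteSpace H]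
    (L : ℝ → SuperOp (H →L[ℂ] H)) (hL : NonSingular L) :
    (∃ Φ : ℝ → SuperOp (H →L[ℂ] H), IsDynamicalMap L Φ ∧ CPDivisible Φ) ↔
      ∀ α : ℝ → ℝ, IsTimeStretching α → NonSingular (fun t => α t • L t) →
        ∃ Φ' : ℝ → SuperOp (H →L[ℂ] H), IsDynamicalMap (fun t => α t • L t) Φ' ∧
          ∀ t : ℝ, 0 ≤ t → IsCP (Φ' t) := by
  constructor
  · rintro ⟨Φ, hΦ, hdiv⟩ α hα hαL
    obtain ⟨Φ', hΦ'⟩ := exists_isDynamicalMap hαL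
    exact ⟨Φ', hΦ', fun t ht => hΦ.isCP_of_cpDivisible hL hdiv hα.1 hαL hΦ' ht⟩
  · intro h
    obtain ⟨Φ, hΦ⟩ := exists_isDynamicalMap hL
    refine ⟨Φ, hΦ, fun a t ha hat => ?_⟩
    have heq : (fun t => (Ioi a).indicator (1 : ℝ → ℝ) t • L t) = (Ioi a).indicator L := by
      ext1 s
      by_cases hs : a < s <;> simp [hs]
    obtain ⟨U, hU, hCP⟩ := h _ (isTimeStretching_indicator a)
      (by rw [heq]; exact LocallyIntegrableOn.indicator hL measurableSet_Ioi)
    rw [heq] at hU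
    exact ⟨U t, hCP t (ha.trans hat.le),
      linear_solution_eq_mul hL hΦ.1 hΦ.2 hU.1 hU.2 ha hat.le⟩
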